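/- Let $(\breve N,\breve g)$ be a semi-Riemannian manifold with Levi-Civita connection $\breve\nabla$, and let $\breve J$ be a smooth $(1,1)$-tensor field on $\breve N$ with $\breve J^2=p\breve J+qI$ for positive integers $p,q$, with $\breve g(\breve JX,Y)=\breve g(X,\breve JY)$ for all vector fields $X,Y$, and with $\breve\nabla\breve J=0$ (a locally metallic semi-Riemannian manifold). Let $N$ be an immersed lightlike submanifold of $\breve N$: the radical distribution $\mathrm{Rad}(TN)=TN\cap TN^{\perp}$ has constant rank $r\ge 1$. Let $S(TN)$ be a screen distribution and $S(TN^{\perp})$ a screen transversal bundle, i.e. smooth subbundles with $TN=\mathrm{Rad}(TN)\oplus S(TN)$ and $TN^{\perp}=\mathrm{Rad}(TN)\oplus S(TN^{\perp})$, and let $\mathrm{ltr}(TN)$ be a lightlike transversal bundle, i.e. a smooth subbundle of $T\breve N|_N$ on which $\breve g$ vanishes, which is orthogonal to $S(TN)$ and to $S(TN^{\perp})$, and for which $T\breve N|_N=TN\oplus \mathrm{ltr}(TN)\oplus S(TN^{\perp})$. For $W,V\in\Gamma(TN)$ let $h^s(W,V)$ denote the $S(TN^{\perp})$-component of $\breve\nabla_WV$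 in this decomposition. Assume that $N$ is radical screen transversal, i.e. $\breve J\,\mathrm{Rad}(TN)\subset S(TN^{\perp})$ and $\breve J\,S(TN)=S(TN)$. Then $S(TN)$ is integrable (that is, $[W,U]\in\Gamma(S(TN))$ for all $W,U\in\Gamma(S(TN))$) if and only if, for all $W,U\in\Gamma(S(TN))$, the field $h^s(W,\breve JU)-h^s(U,\breve JW)$ has no component in $\breve J\,\mathrm{ltr}(TN)$, in the metric sense that $$\breve g\big(h^s(W,\breve JU)-h^s(U,\breve JW),\,\breve J\nu\big)=0$$ at every point of $N$ and for every $\nu$ in the fibre of $\mathrm{ltr}(TN)$ at that point. -/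

import Mathlib

open scoped Manifold ContDiff

noncomputable section

namespace LightlikeGeometry

section Ambient

variable {E : Type*} [NormedAddCommGroup E] [NormedSpace ℝ E]
  {M : Type*} [TopologicalSpace M] [ChartedSpace E M]

variable (E M) in
/-- A semi-Riemannian metric on the (boundaryless, smooth) manifold `M`: a smooth symmetric
nondegenerate `(0,2)`-tensor field of constant index. -/
structure SemiRiemannianMetric [IsManifold 𝓘(ℝ, E) ∞ M] where
  inner : ∀ x : M, TangentSpace 𝓘(ℝ, E) x →L[ℝ] TangentSpace 𝓘(ℝ, E) x →L[ℝ] ℝ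
  symm : ∀ x v w, inner x v w = inner x w v
  nondegenerate : ∀ x v, (∀ w, inner x v w = 0) → v = 0
  contMDiff : ContMDiff 𝓘(ℝ, E) (𝓘(ℝ, E).prod 𝓘(ℝ, E →L[ℝ] E →L[ℝ] ℝ)) ∞
    (fun x => Bundle.TotalSpace.mk' (E →L[ℝ] E →L[ℝ] ℝ) x (inner x))
  /-- the index, i.e. the maximal dimension of a negative definite subspace of `T_x M` -/
  index : ℕ
  isGreatest_index : ∀ x : M, IsGreatest
    {d : ℕ | ∃ V : Submodule ℝ (TangentSpace 𝓘(ℝ, E) x),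
      (∀ v ∈ V, v ≠ 0 → inner x v v < 0) ∧ Module.finrank ℝ V = d} index

variable [IsManifold 𝓘(ℝ, E) ∞ M]

/-- `X` is differentiable at `x` as a vector field on `M`. -/
def VFDiffAt (X : ∀ x : M, TangentSpace 𝓘(ℝ, E) x) (x : M) : Prop :=
  MDifferentiableAt 𝓘(ℝ, E) 𝓘(ℝ, E).tangent
    (fun y => (⟨y, X y⟩ : TangentBundle 𝓘(ℝ, E) M)) x

/-- `X` is a smooth vector field on `M`, i.e. `X ∈ Γ(TM)`. -/
def IsSmoothVF (X : ∀ x : M, TangentSpace 𝓘(ℝ, E) x) : Prop :=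
  ContMDiff 𝓘(ℝ, E) 𝓘(ℝ, E).tangent ∞
    (fun y => (⟨y, X y⟩ : TangentBundle 𝓘(ℝ, E) M))

/-- `cov` is the Levi-Civita connection of `g`: the torsion-free metric connection.
In Mathlib's convention `cov Y x v` is `(∇_v Y)(x)`. -/
structure IsLeviCivita (g : SemiRiemannianMetric E M)
    (cov : CovariantDerivative 𝓘(ℝ, E) E (TangentSpace 𝓘(ℝ, E) : M → Type _)) : Prop where
  smooth : CovariantDerivative.ContMDiffCovariantDerivative cov ∞
  torsionFree : ∀ X Y : (∀ x : M, TangentSpace 𝓘(ℝ, E) x), ∀ x, VFDiffAt X x → VFDiffAt Y x →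
    cov Y x (X x) - cov X x (Y x) = VectorField.mlieBracket 𝓘(ℝ, E) X Y x
  metric : ∀ Y Z : (∀ x : M, TangentSpace 𝓘(ℝ, E) x), ∀ x, VFDiffAt Y x → VFDiffAt Z x →
    ∀ v : TangentSpace 𝓘(ℝ, E) x,
      mvfderiv 𝓘(ℝ, E) (fun y => g.inner y (Y y) (Z y)) x v
        = g.inner x (cov Y x v) (Z x) + g.inner x (Y x) (cov Z x v)

/-- `(M, g, J)` is a metallic semi-Riemannian manifold: `J` is a smooth `(1,1)`-tensor field with
`J² = p J + q I` for positive integers `p, q`, and `g` is `J`-compatible. -/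
structure IsMetallic (g : SemiRiemannianMetric E M) (p q : ℕ)
    (J : ∀ x : M, TangentSpace 𝓘(ℝ, E) x →L[ℝ] TangentSpace 𝓘(ℝ, E) x) : Prop where
  p_pos : 0 < p
  q_pos : 0 < q
  contMDiff : ContMDiff 𝓘(ℝ, E) (𝓘(ℝ, E).prod 𝓘(ℝ, E →L[ℝ] E)) ∞
    (fun x => Bundle.TotalSpace.mk' (E →L[ℝ] E) x (J x))
  sq : ∀ x v, J x (J x v) = (p : ℝ) • J x v + (q : ℝ) • v
  compat : ∀ x v w, g.inner x (J x v) w = g.inner x v (J x w)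

/-- A metallic structure is locally metallic if `J` is parallel: `∇_v (J Y) = J (∇_v Y)`. -/
structure IsLocallyMetallic (g : SemiRiemannianMetric E M)
    (cov : CovariantDerivative 𝓘(ℝ, E) E (TangentSpace 𝓘(ℝ, E) : M → Type _)) (p q : ℕ)
    (J : ∀ x : M, TangentSpace 𝓘(ℝ, E) x →L[ℝ] TangentSpace 𝓘(ℝ, E) x) : Prop
    extends IsMetallic g p q J where
  parallel : ∀ Y : (∀ x : M, TangentSpace 𝓘(ℝ, E) x), ∀ x, VFDiffAt Y x →
    ∀ v : TangentSpace 𝓘(ℝ, E) x, cov (fun y => J y (Y y)) x v = J x (cov Y x v)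

end Ambient

section Along

variable {E : Type*} [NormedAddCommGroup E] [NormedSpace ℝ E]
  {M : Type*} [TopologicalSpace M] [ChartedSpace E M] [IsManifold 𝓘(ℝ, E) ∞ M]
  {F : Type*} [NormedAddCommGroup F] [NormedSpace ℝ F]
  {N : Type*} [TopologicalSpace N] [ChartedSpace F N] [IsManifold 𝓘(ℝ, F) ∞ N]

/-- A family `D x ⊆ T_{f x} M`, `x ∈ N`, is a smooth vector subbundle of `f^* TM`: locally it is
spanned by finitely many smooth, pointwise linearly independent vector fields along `f`.
For `f = id` this says that `D` is a smooth distribution on `M`. -/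
def IsSmoothSubbundle (f : N → M) (D : ∀ x : N, Submodule ℝ (TangentSpace 𝓘(ℝ, E) (f x))) :
    Prop :=
  ∀ x₀ : N, ∃ O : Set N, IsOpen O ∧ x₀ ∈ O ∧
    ∃ (k : ℕ) (s : Fin k → ∀ x : N, TangentSpace 𝓘(ℝ, E) (f x)),
      (∀ i, ContMDiffOn 𝓘(ℝ, F) 𝓘(ℝ, E).tangent ∞
        (fun x => (⟨f x, s i x⟩ : TangentBundle 𝓘(ℝ, E) M)) O) ∧
      ∀ x ∈ O, LinearIndependent ℝ (fun i => s i x) ∧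
        Submodule.span ℝ (Set.range fun i => s i x) = D x

/-- The connection induced by `cov` on vector fields along `f`: `covAlong cov f s x w` is
`(∇_w s)(x)`. In a local frame `e_i` of `TM` near `f x`, writing `s = ∑ sⁱ (e_i ∘ f)`, it is
`∑ (w sⁱ) e_i(f x) + ∑ sⁱ(x) (∇_{df(w)} e_i)(f x)`. Here the `e_i` form the coordinate frame of the
preferred chart at `f x`; the first line is the first sum, and the second sum is the covariant
derivative of the vector field near `f x` with the constant coefficients `sⁱ(x)`, which is
`FiberBundle.extend E (s x)`. -/
def covAlong (cov : CovariantDerivative 𝓘(ℝ, E) E (TangentSpace 𝓘(ℝ, E) : M → Type _))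
    (f : N → M) (s : ∀ x : N, TangentSpace 𝓘(ℝ, E) (f x)) (x : N)
    (w : TangentSpace 𝓘(ℝ, F) x) : TangentSpace 𝓘(ℝ, E) (f x) :=
  (trivializationAt E (TangentSpace 𝓘(ℝ, E)) (f x)).symm (f x)
      (mvfderiv 𝓘(ℝ, F)
        (fun y => (trivializationAt E (TangentSpace 𝓘(ℝ, E)) (f x)
          (⟨f y, s y⟩ : TangentBundle 𝓘(ℝ, E) M)).2) x w)
    + cov (FiberBundle.extend E (s x)) (f x) (mfderiv 𝓘(ℝ, F) 𝓘(ℝ, E) f x w)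

/-- The image `f_* T_x N` of the tangent space of `N`. -/
def tangentImage (f : N → M) (x : N) : Submodule ℝ (TangentSpace 𝓘(ℝ, E) (f x)) :=
  LinearMap.range (mfderiv 𝓘(ℝ, F) 𝓘(ℝ, E) f x).toLinearMap

/-- The image under `f_*` of a subspace of `T_x N`. -/
def pushSub (f : N → M) (x : N) (D : Submodule ℝ (TangentSpace 𝓘(ℝ, F) x)) :
    Submodule ℝ (TangentSpace 𝓘(ℝ, E) (f x)) :=
  D.map (mfderiv 𝓘(ℝ, F) 𝓘(ℝ, E) f x).toLinearMap

/-- The vector field along `f` defined by a vector field on `N`. -/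
def pushVF (f : N → M) (U : ∀ x : N, TangentSpace 𝓘(ℝ, F) x) (x : N) :
    TangentSpace 𝓘(ℝ, E) (f x) :=
  mfderiv 𝓘(ℝ, F) 𝓘(ℝ, E) f x (U x)

/-- The normal space `T_x N^⊥ = {u ∈ T_{f x} M | g(u, v) = 0 for all v ∈ T_x N}`. -/
def normalSpace (g : SemiRiemannianMetric E M) (f : N → M) (x : N) :
    Submodule ℝ (TangentSpace 𝓘(ℝ, E) (f x)) where
  carrier := {u | ∀ v ∈ tangentImage (F := F) f x, g.inner (f x) u v = 0}
  add_mem' ha hb v hv := by simp [ha v hv, hb v hv]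
  zero_mem' v _ := by simp
  smul_mem' c u hu v hv := by simp [hu v hv]

/-- The radical `Rad(T_x N) = T_x N ∩ T_x N^⊥`, as a subspace of `T_x N`. -/
def radical (g : SemiRiemannianMetric E M) (f : N → M) (x : N) :
    Submodule ℝ (TangentSpace 𝓘(ℝ, F) x) :=
  (normalSpace (F := F) g f x).comap (mfderiv 𝓘(ℝ, F) 𝓘(ℝ, E) f x).toLinearMap

variable (N) in
/-- A lightlike submanifold `(N, S(TN), S(TN^⊥), ltr(TN))` of `(M, g)`, immersed by `toFun`.
The bundles `S(TN)` and `S(TN^⊥)` are complements of the radical in `TN` and `TN^⊥`, hence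
`g` is automatically nondegenerate on them. -/
structure LightlikeSubmanifold (g : SemiRiemannianMetric E M) where
  toFun : N → M
  contMDiff : ContMDiff 𝓘(ℝ, F) 𝓘(ℝ, E) ∞ toFun
  injective_mfderiv : ∀ x : N, Function.Injective (mfderiv 𝓘(ℝ, F) 𝓘(ℝ, E) toFun x)
  /-- the rank of the radical distribution -/
  r : ℕ
  one_le_r : 1 ≤ r
  finrank_radical : ∀ x : N, Module.finrank ℝ (radical (F := F) g toFun x) = r
  /-- the screen distribution `S(TN)` -/
  screen : ∀ x : N, Submodule ℝ (TangentSpace 𝓘(ℝ, F) x)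
  screen_smooth : IsSmoothSubbundle (F := F) (id : N → N) screen
  screen_isCompl : ∀ x, IsCompl (radical (F := F) g toFun x) (screen x)
  /-- the screen transversal bundle `S(TN^⊥)` -/
  screenTrans : ∀ x : N, Submodule ℝ (TangentSpace 𝓘(ℝ, E) (toFun x))
  screenTrans_smooth : IsSmoothSubbundle (F := F) toFun screenTrans
  screenTrans_disjoint : ∀ x,
    Disjoint (pushSub toFun x (radical (F := F) g toFun x)) (screenTrans x)
  screenTrans_sup : ∀ x,
    pushSub toFun x (radical (F := F) g toFun x) ⊔ screenTrans x = normalSpace (F := F) g toFun x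
  /-- the lightlike transversal bundle `ltr(TN)` -/
  ltr : ∀ x : N, Submodule ℝ (TangentSpace 𝓘(ℝ, E) (toFun x))
  ltr_smooth : IsSmoothSubbundle (F := F) toFun ltr
  ltr_lightlike : ∀ x, ∀ n ∈ ltr x, ∀ n' ∈ ltr x, g.inner (toFun x) n n' = 0
  ltr_orth_screen : ∀ x, ∀ n ∈ ltr x, ∀ v ∈ pushSub toFun x (screen x),
    g.inner (toFun x) n v = 0
  ltr_orth_screenTrans : ∀ x, ∀ n ∈ ltr x, ∀ z ∈ screenTrans x, g.inner (toFun x) n z = 0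
  /-- `tr(TN) = ltr(TN) ⊕ S(TN^⊥)` is a direct sum ... -/
  tr_disjoint : ∀ x, Disjoint (ltr x) (screenTrans x)
  /-- ... and `TM|_N = TN ⊕ tr(TN)`. -/
  tr_isCompl : ∀ x, IsCompl (tangentImage (F := F) toFun x) (ltr x ⊔ screenTrans x)

namespace LightlikeSubmanifold

variable {g : SemiRiemannianMetric E M} (L : LightlikeSubmanifold (F := F) N g)

theorem screenTrans_isCompl (x : N) :
    IsCompl (L.screenTrans x) (tangentImage (F := F) L.toFun x ⊔ L.ltr x) where
  disjoint := ((L.tr_disjoint x).disjoint_sup_left_of_disjoint_sup_right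
    (L.tr_isCompl x).disjoint).symm
  codisjoint := by
    rw [codisjoint_iff, sup_comm, sup_assoc]
    exact codisjoint_iff.mp (L.tr_isCompl x).codisjoint

/-- The screen second fundamental form: `h^s(W, V)` is the `S(TN^⊥)`-component of `∇_W V` in
`TM|_N = TN ⊕ ltr(TN) ⊕ S(TN^⊥)`, for a tangent field `V ∈ Γ(TN)`, which is given here as the vector
field along the immersion that it defines. -/
def hs (cov : CovariantDerivative 𝓘(ℝ, E) E (TangentSpace 𝓘(ℝ, E) : M → Type _))
    (W : ∀ x : N, TangentSpace 𝓘(ℝ, F) x) (V : ∀ x : N, TangentSpace 𝓘(ℝ, E) (L.toFun x))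
    (x : N) : TangentSpace 𝓘(ℝ, E) (L.toFun x) :=
  Submodule.projection (L.screenTrans x) (tangentImage (F := F) L.toFun x ⊔ L.ltr x)
    (L.screenTrans_isCompl x) (covAlong cov L.toFun V x (W x))

/-- `L` is radical screen transversal: `J Rad(TN) ⊆ S(TN^⊥)` and `J S(TN) = S(TN)`. -/
structure IsRadicalScreenTransversal
    (J : ∀ x : M, TangentSpace 𝓘(ℝ, E) x →L[ℝ] TangentSpace 𝓘(ℝ, E) x) : Prop where
  map_radical_le : ∀ x,
    (pushSub L.toFun x (radical (F := F) g L.toFun x)).map (J (L.toFun x)).toLinearMap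
      ≤ L.screenTrans x
  map_screen_eq : ∀ x,
    (pushSub L.toFun x (L.screen x)).map (J (L.toFun x)).toLinearMap
      = pushSub L.toFun x (L.screen x)

end LightlikeSubmanifold

end Along

section Distributions

variable {F : Type*} [NormedAddCommGroup F] [NormedSpace ℝ F]
  {N : Type*} [TopologicalSpace N] [ChartedSpace F N] [IsManifold 𝓘(ℝ, F) ∞ N]

/-- `X ∈ Γ(D)`: `X` is a smooth vector field with values in the distribution `D`. -/
def IsSectionOf (D : ∀ x : N, Submodule ℝ (TangentSpace 𝓘(ℝ, F) x))
    (X : ∀ x : N, TangentSpace 𝓘(ℝ, F) x) : Prop :=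
  IsSmoothVF X ∧ ∀ x, X x ∈ D x

/-- A distribution is integrable if `[X, Y] ∈ Γ(D)` for all `X, Y ∈ Γ(D)`. -/
def IsIntegrable (D : ∀ x : N, Submodule ℝ (TangentSpace 𝓘(ℝ, F) x)) : Prop :=
  ∀ X Y : (∀ x : N, TangentSpace 𝓘(ℝ, F) x), IsSectionOf D X → IsSectionOf D Y →
    ∀ x, VectorField.mlieBracket 𝓘(ℝ, F) X Y x ∈ D x

end Distributions

/-- A vector `v ∈ T_x M` has no component in (i.e. along) the subspace `D`, in the metric sense:
`g(v, d) = 0` for every `d ∈ D`. -/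
def HasNoComponentIn {E : Type*} [NormedAddCommGroup E] [NormedSpace ℝ E]
    {M : Type*} [TopologicalSpace M] [ChartedSpace E M] [IsManifold 𝓘(ℝ, E) ∞ M]
    (g : SemiRiemannianMetric E M) (x : M) (v : TangentSpace 𝓘(ℝ, E) x)
    (D : Submodule ℝ (TangentSpace 𝓘(ℝ, E) x)) : Prop :=
  ∀ d ∈ D, g.inner x v d = 0

end LightlikeGeometry

end

/-! Since `J` is parallel and the connection is torsion-free, `∇_W JU - ∇_U JW = J[W, U]`, so the
difference of the two `h^s` terms is the `S(TN^⊥)`-part of `J[W, U]` (`hs_sub_hs`). Write `[W, U] =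
ξ + s` with `ξ` radical and `s` in the screen: `Js` is tangent and `Jξ` lies in `S(TN^⊥)`, so that
part is exactly `Jξ`. Finally `g(Jξ, Jν) = p g(Jξ, ν) + q g(ξ, ν) = q g(ξ, ν)`, because `S(TN^⊥)` is
orthogonal to `ltr(TN)`. As `q ≠ 0` and no nonzero radical vector is orthogonal to `ltr(TN)`, the
metric condition says `ξ = 0`, i.e. `[W, U]` lies in the screen. The equivalence holds point by
point for each pair of fields.

The analytic work is to transfer parallelism and torsion-freeness to fields along the immersion
(`covAlong_parallel`, `covAlong_pushVF_sub_covAlong_pushVF`), since such fields need not be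
restrictions of ambient ones. -/

namespace LightlikeGeometry

/-! ### Derivatives in charts and the Lie bracket as a commutator. -/

section Bracket
open VectorField Filter Topology

variable {F : Type*} [NormedAddCommGroup F] [NormedSpace ℝ F]
  {N : Type*} [TopologicalSpace N] [ChartedSpace F N]
  {G : Type*} [NormedAddCommGroup G] [NormedSpace ℝ G]

theorem mvfderiv_congr {f g : N → G} {x : N} (h : f =ᶠ[𝓝 x] g) :
    mvfderiv 𝓘(ℝ, F) f x = mvfderiv 𝓘(ℝ, F) g x := by
  ext v
  exact congr($(h.mfderiv_eq) v)

theorem contDiffAt_comp_extChartAt_symm {f : N → G} {x : N} {n : ℕ∞ω}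
    (hf : ContMDiffAt 𝓘(ℝ, F) 𝓘(ℝ, G) n f x) :
    ContDiffAt ℝ n (f ∘ (extChartAt 𝓘(ℝ, F) x).symm) (extChartAt 𝓘(ℝ, F) x x) := by
  have := (contMDiffAt_iff.1 hf).2
  simpa only [extChartAt_model_space_eq_id, PartialEquiv.refl_coe, Function.id_comp,
    modelWithCornersSelf_coe, Set.range_id, contDiffWithinAt_univ] using this

variable [IsManifold 𝓘(ℝ, F) ∞ N]

-- The product rule needed to differentiate the coordinate matrix of `J` applied to the coordinates
-- of a field.
omit [IsManifold 𝓘(ℝ, F) ∞ N] in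
theorem mvfderiv_clm_apply {H : Type*} [NormedAddCommGroup H] [NormedSpace ℝ H]
    {A : N → G →L[ℝ] H} {u : N → G} {x : N}
    (hA : MDifferentiableAt 𝓘(ℝ, F) 𝓘(ℝ, G →L[ℝ] H) A x)
    (hu : MDifferentiableAt 𝓘(ℝ, F) 𝓘(ℝ, G) u x) (w : TangentSpace 𝓘(ℝ, F) x) :
    mvfderiv 𝓘(ℝ, F) (fun y => A y (u y)) x w =
      mvfderiv 𝓘(ℝ, F) A x w (u x) + A x (mvfderiv 𝓘(ℝ, F) u x w) := by
  have hA' := hA.differentiableWithinAt_writtenInExtChartAt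
  have hu' := hu.differentiableWithinAt_writtenInExtChartAt
  rw [(hA.clm_apply hu).mvfderiv, hA.mvfderiv, hu.mvfderiv]
  have := fderivWithin_clm_apply (𝓘(ℝ, F).uniqueDiffOn _ (Set.mem_range_self _)) hA' hu'
  refine congr($this w).trans ((add_comm _ _).trans ?_)
  -- The rule in the chart evaluates `u` and `A` at the round trip of `x` through the chart; this
  -- exposes that point so that it can be replaced by `x`.
  change (fderivWithin ℝ (writtenInExtChartAt 𝓘(ℝ, F) 𝓘(ℝ, G →L[ℝ] H) x A)
      (Set.range 𝓘(ℝ, F)) (extChartAt 𝓘(ℝ, F) x x) w : G →L[ℝ] H)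
      (u ((extChartAt 𝓘(ℝ, F) x).symm (extChartAt 𝓘(ℝ, F) x x)))
    + A ((extChartAt 𝓘(ℝ, F) x).symm (extChartAt 𝓘(ℝ, F) x x))
      (fderivWithin ℝ (writtenInExtChartAt 𝓘(ℝ, F) 𝓘(ℝ, G) x u)
        (Set.range 𝓘(ℝ, F)) (extChartAt 𝓘(ℝ, F) x x) w) = _
  rw [extChartAt_to_inv]
  rfl

omit [IsManifold 𝓘(ℝ, F) ∞ N] in
theorem mvfderiv_comp_mfderiv {E : Type*} [NormedAddCommGroup E] [NormedSpace ℝ E]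
    {M : Type*} [TopologicalSpace M] [ChartedSpace E M] {g : M → G} {f : N → M} {x : N}
    (hg : MDifferentiableAt 𝓘(ℝ, E) 𝓘(ℝ, G) g (f x))
    (hf : MDifferentiableAt 𝓘(ℝ, F) 𝓘(ℝ, E) f x) (w : TangentSpace 𝓘(ℝ, F) x) :
    mvfderiv 𝓘(ℝ, F) (g ∘ f) x w =
      mvfderiv 𝓘(ℝ, E) g (f x) (mfderiv 𝓘(ℝ, F) 𝓘(ℝ, E) f x w) := by
  rw [mvfderiv, mvfderiv, mfderiv_comp x hg hf]
  rfl

/-- Near `x`, the derivative of `f` is computed in the chart at `x`. -/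
theorem eventually_mvfderiv_eq_fderiv {f : N → G} {x : N}
    (hf : ContMDiffAt 𝓘(ℝ, F) 𝓘(ℝ, G) 1 f x) :
    ∀ᶠ y in 𝓝 x, ∀ v : TangentSpace 𝓘(ℝ, F) y, mvfderiv 𝓘(ℝ, F) f y v =
      fderiv ℝ (f ∘ (extChartAt 𝓘(ℝ, F) x).symm) (extChartAt 𝓘(ℝ, F) x y)
        (mfderiv 𝓘(ℝ, F) 𝓘(ℝ, F) (extChartAt 𝓘(ℝ, F) x) y v) := by
  set ψ := extChartAt 𝓘(ℝ, F) x with hψ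
  set h : F → G := f ∘ ψ.symm with hh
  have : IsManifold 𝓘(ℝ, F) 1 N := .of_le (n := ∞) (by simp)
  have hdiff : ∀ᶠ y in 𝓝 x, DifferentiableAt ℝ h (ψ y) :=
    (continuousAt_extChartAt x).eventually
      (((contDiffAt_comp_extChartAt_symm hf).eventually (by simp)).mono
        fun z hz => hz.differentiableAt (by norm_num))
  filter_upwards [hdiff, extChartAt_source_mem_nhds (I := 𝓘(ℝ, F)) x] with y hy hys v
  have hfh : f =ᶠ[𝓝 y] h ∘ ψ := by
    filter_upwards [(isOpen_extChartAt_source (I := 𝓘(ℝ, F)) x).mem_nhds hys] with z hz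
    simp [hh, ψ.left_inv hz]
  rw [mvfderiv_congr hfh, mvfderiv, mfderiv_comp y hy.mdifferentiableAt
    (mdifferentiableAt_extChartAt (by simpa using hys)), mfderiv_eq_fderiv]
  rfl

/-- Near `x`, a vector field is represented in the chart at `x` by its pullback under the inverse
chart. -/
theorem eventually_mfderiv_extChartAt_apply (x : N) (U : ∀ y : N, TangentSpace 𝓘(ℝ, F) y) :
    ∀ᶠ y in 𝓝 x, mfderiv 𝓘(ℝ, F) 𝓘(ℝ, F) (extChartAt 𝓘(ℝ, F) x) y (U y) =
      mpullbackWithin 𝓘(ℝ, F) 𝓘(ℝ, F) (extChartAt 𝓘(ℝ, F) x).symm U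
          (Set.range 𝓘(ℝ, F)) (extChartAt 𝓘(ℝ, F) x y) := by
  have : IsManifold 𝓘(ℝ, F) 1 N := .of_le (n := ∞) (by simp)
  have h := eventuallyEq_mpullback_mpullbackWithin_extChartAt (I := 𝓘(ℝ, F)) (x := x)
    (s := Set.univ) U
  rw [nhdsWithin_univ] at h
  filter_upwards [h, extChartAt_source_mem_nhds (I := 𝓘(ℝ, F)) x] with y hy hys
  rw [mpullback_apply] at hy
  exact ((isInvertible_mfderiv_extChartAt hys).inverse_apply_eq.1 hy.symm).symm

/-- The symmetry of second derivatives of a vector-valued function on a manifold: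
`df([W, U]) = W(U f) - U(W f)`. -/
theorem mvfderiv_mlieBracket [CompleteSpace F] {f : N → G} {x : N}
    (hf : ContMDiffAt 𝓘(ℝ, F) 𝓘(ℝ, G) 2 f x)
    {W U : ∀ y : N, TangentSpace 𝓘(ℝ, F) y} (hW : VFDiffAt W x) (hU : VFDiffAt U x) :
    mvfderiv 𝓘(ℝ, F) f x (mlieBracket 𝓘(ℝ, F) W U x) =
      mvfderiv 𝓘(ℝ, F) (fun y => mvfderiv 𝓘(ℝ, F) f y (U y)) x (W x)
        - mvfderiv 𝓘(ℝ, F) (fun y => mvfderiv 𝓘(ℝ, F) f y (W y)) x (U x) := by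
  have : IsManifold 𝓘(ℝ, F) 2 N := inferInstance
  have : IsManifold 𝓘(ℝ, F) 1 N := .of_le (n := ∞) (by simp)
  have hf' := eventually_mvfderiv_eq_fderiv (hf.of_le (by norm_num))
  have hh2 := contDiffAt_comp_extChartAt_symm hf
  set ψ := extChartAt 𝓘(ℝ, F) x with hψ
  set h : F → G := f ∘ ψ.symm with hh
  have hdh : DifferentiableAt ℝ (fderiv ℝ h) (ψ x) :=
    (hh2.fderiv_right (m := 1) (by norm_num)).differentiableAt (by norm_num)
  let c (A : ∀ y : N, TangentSpace 𝓘(ℝ, F) y) : F → F :=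
    mpullbackWithin 𝓘(ℝ, F) 𝓘(ℝ, F) ψ.symm A (Set.range 𝓘(ℝ, F))
  have hc (A : ∀ y : N, TangentSpace 𝓘(ℝ, F) y) :
      ∀ᶠ y in 𝓝 x, mfderiv 𝓘(ℝ, F) 𝓘(ℝ, F) ψ y (A y) = c A (ψ y) :=
    eventually_mfderiv_extChartAt_apply x A
  -- `B(A f)` in coordinates is a Hessian term, symmetric in `A` and `B`, plus a term whose
  -- antisymmetrization is `dh` of the coordinate bracket.
  have key (A B : ∀ y : N, TangentSpace 𝓘(ℝ, F) y) (hA : VFDiffAt A x) :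
      mvfderiv 𝓘(ℝ, F) (fun y => mvfderiv 𝓘(ℝ, F) f y (A y)) x (B x) =
          fderiv ℝ (fderiv ℝ h) (ψ x) (c B (ψ x)) (c A (ψ x))
            + fderiv ℝ h (ψ x) (fderiv ℝ (c A) (ψ x) (c B (ψ x))) := by
    have ha : DifferentiableAt ℝ (c A) (ψ x) := by
      have : DifferentiableWithinAt ℝ (c A) (ψ.symm ⁻¹' Set.univ ∩ Set.range 𝓘(ℝ, F)) (ψ x) :=
        MDifferentiableWithinAt.differentiableWithinAt_mpullbackWithin_vectorField
          (hA.mdifferentiableWithinAt (s := Set.univ))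
      rwa [modelWithCornersSelf_coe, Set.range_id, Set.preimage_univ, Set.univ_inter,
        differentiableWithinAt_univ] at this
    have hk : (fun y => mvfderiv 𝓘(ℝ, F) f y (A y)) =ᶠ[𝓝 x]
        (fun z => fderiv ℝ h z (c A z)) ∘ ψ := by
      filter_upwards [hf', hc A] with y h1 h2
      rw [h1, h2]
      rfl
    have hkd : DifferentiableAt ℝ (fun z => fderiv ℝ h z (c A z)) (ψ x) := hdh.clm_apply ha
    rw [mvfderiv_congr hk, mvfderiv, mfderiv_comp x hkd.mdifferentiableAt
      (mdifferentiableAt_extChartAt (by simp)), mfderiv_eq_fderiv]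
    change fderiv ℝ (fun z => fderiv ℝ h z (c A z)) (ψ x)
      (mfderiv 𝓘(ℝ, F) 𝓘(ℝ, F) ψ x (B x)) = _
    rw [(hc B).self_of_nhds, fderiv_clm_apply hdh ha]
    simp [add_comm]
  have hbr : mfderiv 𝓘(ℝ, F) 𝓘(ℝ, F) ψ x (mlieBracket 𝓘(ℝ, F) W U x) =
      fderiv ℝ (c U) (ψ x) (c W (ψ x)) - fderiv ℝ (c W) (ψ x) (c U (ψ x)) := by
    rw [← mlieBracketWithin_univ, mlieBracketWithin_apply]
    refine ((isInvertible_mfderiv_extChartAt (I := 𝓘(ℝ, F))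
      (mem_extChartAt_source x)).inverse_apply_eq.1 rfl).symm.trans ?_
    change lieBracketWithin ℝ (c W) (c U) (ψ.symm ⁻¹' Set.univ ∩ Set.range 𝓘(ℝ, F)) (ψ x) = _
    rw [modelWithCornersSelf_coe, Set.range_id, Set.preimage_univ, Set.univ_inter,
      lieBracketWithin_univ, lieBracket]
  rw [hf'.self_of_nhds, key U W hU, key W U hW, hbr, map_sub,
    (hh2.isSymmSndFDerivAt (by simp)).eq (c U (ψ x)) (c W (ψ x))]
  abel

end Bracket

/-! ### Coordinate formula for connections, and parallel endomorphisms along a map. -/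

section Connection
open Bundle FiberBundle VectorField Filter Topology

variable {E : Type*} [NormedAddCommGroup E] [NormedSpace ℝ E] [FiniteDimensional ℝ E]
  {M : Type*} [TopologicalSpace M] [ChartedSpace E M] [IsManifold 𝓘(ℝ, E) ∞ M]
  {G : Type*} [NormedAddCommGroup G] [NormedSpace ℝ G]

/-- The coordinate formula for a covariant derivative. -/
theorem cov_eq_mvfderiv_add_cov_extend
    (cov : CovariantDerivative 𝓘(ℝ, E) E (TangentSpace 𝓘(ℝ, E) : M → Type _))
    {X : ∀ y : M, TangentSpace 𝓘(ℝ, E) y} {x : M} (hX : VFDiffAt X x)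
    (v : TangentSpace 𝓘(ℝ, E) x) :
    cov X x v = (trivializationAt E (TangentSpace 𝓘(ℝ, E)) x).symm x
        (mvfderiv 𝓘(ℝ, E) (fun y => (trivializationAt E (TangentSpace 𝓘(ℝ, E)) x
          (⟨y, X y⟩ : TangentBundle 𝓘(ℝ, E) M)).2) x v)
      + cov (FiberBundle.extend E (X x)) x v := by
  set t := trivializationAt E (TangentSpace 𝓘(ℝ, E) : M → Type _) x with ht
  have hx : x ∈ t.baseSet := FiberBundle.mem_baseSet_trivializationAt' x
  have hlin (y : M) (hy : y ∈ t.baseSet) (w : TangentSpace 𝓘(ℝ, E) y) :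
      (t ⟨y, w⟩).2 = t.continuousLinearMapAt ℝ y w :=
    (t.continuousLinearMapAt_apply_of_mem ℝ hy w).symm
  have hnear : ∀ᶠ y in 𝓝 x, y ∈ t.baseSet := t.open_baseSet.mem_nhds hx
  let D (X : ∀ y : M, TangentSpace 𝓘(ℝ, E) y) : E :=
    mvfderiv 𝓘(ℝ, E) (fun y => (t ⟨y, X y⟩).2) x v
  -- Both terms obey the same Leibniz rule, so their difference is tensorial and depends only on `X
  -- x`; it can be evaluated on the extension of `X x` with constant coefficients.
  let Φ (X : ∀ y : M, TangentSpace 𝓘(ℝ, E) y) : TangentSpace 𝓘(ℝ, E) x :=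
    cov X x v - t.symmL ℝ x (D X)
  have hΦ : TensorialAt 𝓘(ℝ, E) E Φ x := by
    constructor
    · intro f σ hf hσ
      have hσ' := (mdifferentiableAt_section (IB := 𝓘(ℝ, E)) σ).1 hσ
      have h1 : D (f • σ) = f x • D σ + mvfderiv 𝓘(ℝ, E) f x v • (t ⟨x, σ x⟩).2 := by
        have : (fun y => (t ⟨y, (f • σ) y⟩).2) =ᶠ[𝓝 x] f • (fun y => (t ⟨y, σ y⟩).2) := by
          filter_upwards [hnear] with y hy
          simp [hlin y hy]
        simp only [D]
        rw [mvfderiv_congr this, mvfderiv_smul hf hσ']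
        simp [← ht]
      simp only [Φ, h1, cov.isCovariantDerivativeOn.leibniz hσ hf (s := Set.univ), map_add, map_smul,
        hlin x hx, t.symmL_continuousLinearMapAt hx]
      simp
      module
    · intro σ σ' hσ hσ'
      have h1 : D (σ + σ') = D σ + D σ' := by
        have : (fun y => (t ⟨y, (σ + σ') y⟩).2) =ᶠ[𝓝 x]
            (fun y => (t ⟨y, σ y⟩).2) + (fun y => (t ⟨y, σ' y⟩).2) := by
          filter_upwards [hnear] with y hy
          simp [hlin y hy]
        simp only [D]
        rw [mvfderiv_congr this, mvfderiv_add
          ((mdifferentiableAt_section (IB := 𝓘(ℝ, E)) σ).1 hσ)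
          ((mdifferentiableAt_section (IB := 𝓘(ℝ, E)) σ').1 hσ')]
        simp [← ht]
      simp only [Φ, h1, cov.isCovariantDerivativeOn.add hσ hσ' (s := Set.univ), map_add]
      simp
      module
  have h := hΦ.pointwise hX (mdifferentiableAt_extend 𝓘(ℝ, E) E (X x)) (by simp)
  have h0 : D (extend E (X x)) = 0 := by
    have : (fun y => (t ⟨y, extend E (X x) y⟩).2) =ᶠ[𝓝 x] fun _ => (t ⟨x, X x⟩).2 := by
      filter_upwards [hnear] with y hy
      simp [extend, hy, ← ht]
    simp only [D]
    rw [mvfderiv_congr this, mvfderiv_const]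
    simp
  simp only [Φ, h0, map_zero, sub_zero] at h
  have hs := t.symmL_apply (R := ℝ) hx (D X)
  rw [hs] at h
  exact sub_eq_iff_eq_add'.1 h


variable {F : Type*} [NormedAddCommGroup F] [NormedSpace ℝ F]
  {N : Type*} [TopologicalSpace N] [ChartedSpace F N]

/-- The connection along `f` commutes with a parallel endomorphism field. -/
theorem covAlong_parallel
    {cov : CovariantDerivative 𝓘(ℝ, E) E (TangentSpace 𝓘(ℝ, E) : M → Type _)}
    {J : ∀ x : M, TangentSpace 𝓘(ℝ, E) x →L[ℝ] TangentSpace 𝓘(ℝ, E) x}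
    (hJ : ContMDiff 𝓘(ℝ, E) (𝓘(ℝ, E).prod 𝓘(ℝ, E →L[ℝ] E)) ∞
      (fun x => Bundle.TotalSpace.mk' (E →L[ℝ] E) x (J x)))
    (hpar : ∀ Y : (∀ x : M, TangentSpace 𝓘(ℝ, E) x), ∀ x, VFDiffAt Y x →
      ∀ v : TangentSpace 𝓘(ℝ, E) x, cov (fun y => J y (Y y)) x v = J x (cov Y x v))
    {f : N → M} {s : ∀ x : N, TangentSpace 𝓘(ℝ, E) (f x)} {x : N}
    (hf : MDifferentiableAt 𝓘(ℝ, F) 𝓘(ℝ, E) f x)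
    (hs : MDifferentiableAt 𝓘(ℝ, F) 𝓘(ℝ, E).tangent
      (fun y => (⟨f y, s y⟩ : TangentBundle 𝓘(ℝ, E) M)) x)
    (w : TangentSpace 𝓘(ℝ, F) x) :
    covAlong cov f (fun y => J (f y) (s y)) x w = J (f x) (covAlong cov f s x w) := by
  set t := trivializationAt E (TangentSpace 𝓘(ℝ, E) : M → Type _) (f x) with ht
  have hx : f x ∈ t.baseSet := FiberBundle.mem_baseSet_trivializationAt' (f x)
  have hnear : ∀ᶠ y in 𝓝 (f x), y ∈ t.baseSet := t.open_baseSet.mem_nhds hx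
  -- The matrix of `J` in the trivialization at `f x`. As `s` lives only along `f`, parallelism is
  -- applied to the constant-coefficient extension of `s x`, and the derivative of this matrix
  -- accounts for the discrepancy.
  let Jt (y : M) : E →L[ℝ] E := ContinuousLinearMap.inCoordinates E
    (TangentSpace 𝓘(ℝ, E) : M → Type _) E (TangentSpace 𝓘(ℝ, E) : M → Type _)
    (f x) y (f x) y (J y)
  have hJt : MDifferentiableAt 𝓘(ℝ, E) 𝓘(ℝ, E →L[ℝ] E) Jt (f x) :=
    ((contMDiffAt_hom_bundle _).1 (hJ (f x))).2.mdifferentiableAt (by simp)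
  have hJapp (y : M) (hy : y ∈ t.baseSet) (v : TangentSpace 𝓘(ℝ, E) y) :
      (t ⟨y, J y v⟩).2 = Jt y (t ⟨y, v⟩).2 := by
    have : (t ⟨y, v⟩).2 = t.continuousLinearEquivAt ℝ y hy v := rfl
    simp only [Jt, ContinuousLinearMap.inCoordinates_eq hy hy, ← ht, this,
      ContinuousLinearMap.comp_apply, ContinuousLinearEquiv.coe_coe,
      ContinuousLinearEquiv.symm_apply_apply]
    rfl
  have hst : MDifferentiableAt 𝓘(ℝ, F) 𝓘(ℝ, E) (fun y => (t ⟨f y, s y⟩).2) x :=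
    ((mdifferentiableAt_totalSpace _ _).1 hs).2
  have hsymm (a : E) : t.symm (f x) (Jt (f x) a) = J (f x) (t.symm (f x) a) := by
    have h := hJapp (f x) hx (t.symm (f x) a)
    rw [t.apply_mk_symm hx] at h
    rw [← h]
    exact t.symm_apply_apply_mk hx _
  have h1 : mvfderiv 𝓘(ℝ, F) (fun y => (t ⟨f y, J (f y) (s y)⟩).2) x w =
      mvfderiv 𝓘(ℝ, E) Jt (f x) (mfderiv 𝓘(ℝ, F) 𝓘(ℝ, E) f x w) (t ⟨f x, s x⟩).2
        + Jt (f x) (mvfderiv 𝓘(ℝ, F) (fun y => (t ⟨f y, s y⟩).2) x w) := by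
    have : (fun y => (t ⟨f y, J (f y) (s y)⟩).2) =ᶠ[𝓝 x]
        fun y => (Jt ∘ f) y (t ⟨f y, s y⟩).2 := by
      filter_upwards [hf.continuousAt.eventually hnear] with y hy
      exact hJapp _ hy _
    rw [mvfderiv_congr this, mvfderiv_clm_apply (hJt.comp x hf) hst, mvfderiv_comp_mfderiv hJt hf]
    rfl
  -- The `d(Jt)` term here is the same one that the product rule produces in `h1`, so `hpar` absorbs
  -- it.
  have h2 : cov (fun y => J y (extend E (s x) y)) (f x) (mfderiv 𝓘(ℝ, F) 𝓘(ℝ, E) f x w) =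
      t.symm (f x) (mvfderiv 𝓘(ℝ, E) Jt (f x) (mfderiv 𝓘(ℝ, F) 𝓘(ℝ, E) f x w) (t ⟨f x, s x⟩).2)
        + cov (extend E (J (f x) (s x))) (f x) (mfderiv 𝓘(ℝ, F) 𝓘(ℝ, E) f x w) := by
    have : (fun y => (t ⟨y, J y (extend E (s x) y)⟩).2) =ᶠ[𝓝 (f x)]
        fun y => Jt y (t ⟨f x, s x⟩).2 := by
      filter_upwards [hnear] with y hy
      rw [hJapp _ hy]
      simp [extend, hy, ← ht]
    have hd : MDifferentiableAt 𝓘(ℝ, E) 𝓘(ℝ, E) (fun y => Jt y (t ⟨f x, s x⟩).2) (f x) :=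
      hJt.clm_apply mdifferentiableAt_const
    have hdiff : VFDiffAt (fun y => J y (extend E (s x) y)) (f x) :=
      (mdifferentiableAt_section (IB := 𝓘(ℝ, E)) _).2 (hd.congr_of_eventuallyEq this)
    rw [cov_eq_mvfderiv_add_cov_extend cov hdiff, ← ht, mvfderiv_congr this,
      mvfderiv_clm_apply hJt mdifferentiableAt_const]
    simp [mvfderiv_const]
  have h3 := hpar (extend E (s x)) (f x) (mdifferentiableAt_extend 𝓘(ℝ, E) E (s x))
    (mfderiv 𝓘(ℝ, F) 𝓘(ℝ, E) f x w)
  have hadd (a b : E) : t.symm (f x) (a + b) = t.symm (f x) a + t.symm (f x) b := by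
    have := map_add (t.symmL ℝ (f x)) a b
    simpa only [t.symmL_apply (R := ℝ) hx] using this
  rw [covAlong, covAlong, ← ht, h1, hadd, map_add, ← h3, h2, hsymm]
  abel

end Connection

/-! ### Torsion-freeness along a map. -/

section PushForward
open Bundle FiberBundle VectorField Filter Topology

variable {E : Type*} [NormedAddCommGroup E] [NormedSpace ℝ E]
  {M : Type*} [TopologicalSpace M] [ChartedSpace E M] [IsManifold 𝓘(ℝ, E) ∞ M]

/-- The tangent bundle trivialization at `p` is the derivative of the chart at `p`. -/
theorem trivializationAt_tangentSpace_snd {p y : M} (hy : y ∈ (chartAt E p).source)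
    (v : TangentSpace 𝓘(ℝ, E) y) :
    (trivializationAt E (TangentSpace 𝓘(ℝ, E)) p (⟨y, v⟩ : TangentBundle 𝓘(ℝ, E) M)).2 =
      mvfderiv 𝓘(ℝ, E) (extChartAt 𝓘(ℝ, E) p) y v := by
  have h := Trivialization.continuousLinearMapAt_apply_of_mem ℝ
    (e := trivializationAt E (TangentSpace 𝓘(ℝ, E) : M → Type _) p) hy v
  rw [← h, TangentBundle.continuousLinearMapAt_trivializationAt hy]
  rfl

/-- Order two is what the symmetry of second derivatives in `mvfderiv_mlieBracket` requires. -/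
theorem contMDiffAt_two_extChartAt {p y : M} (hy : y ∈ (chartAt E p).source) :
    ContMDiffAt 𝓘(ℝ, E) 𝓘(ℝ, E) 2 (extChartAt 𝓘(ℝ, E) p) y :=
  have : IsManifold 𝓘(ℝ, E) 2 M := inferInstance
  contMDiffAt_extChartAt' hy

/-- Coordinate vector fields commute at the centre of the chart. -/
theorem mlieBracket_extend [CompleteSpace E] {p : M} (a b : TangentSpace 𝓘(ℝ, E) p) :
    mlieBracket 𝓘(ℝ, E) (extend E a) (extend E b) p = 0 := by
  set t := trivializationAt E (TangentSpace 𝓘(ℝ, E) : M → Type _) p with ht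
  -- The chart differential of a coordinate field is locally constant, so both iterated derivatives
  -- in the bracket formula vanish.
  have hconst (c : TangentSpace 𝓘(ℝ, E) p) :
      (fun y => mvfderiv 𝓘(ℝ, E) (extChartAt 𝓘(ℝ, E) p) y (extend E c y)) =ᶠ[𝓝 p]
        fun _ => (t ⟨p, c⟩).2 := by
    filter_upwards [(chartAt E p).open_source.mem_nhds (mem_chart_source E p)] with y hy
    have hy' : y ∈ t.baseSet := hy
    rw [← trivializationAt_tangentSpace_snd hy]
    simp [extend, hy', ← ht]
  have h := mvfderiv_mlieBracket (contMDiffAt_two_extChartAt (mem_chart_source E p))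
    (mdifferentiableAt_extend 𝓘(ℝ, E) E a) (mdifferentiableAt_extend 𝓘(ℝ, E) E b)
  rw [mvfderiv_congr (hconst a), mvfderiv_congr (hconst b), mvfderiv_const, mvfderiv_const] at h
  simp only [zero_apply, sub_zero] at h
  have : IsManifold 𝓘(ℝ, E) 1 M := .of_le (n := ∞) (by simp)
  exact (isInvertible_mfderiv_extChartAt (I := 𝓘(ℝ, E)) (mem_extChartAt_source p)).injective
    (h.trans (map_zero _).symm)

variable {F : Type*} [NormedAddCommGroup F] [NormedSpace ℝ F]
  {N : Type*} [TopologicalSpace N] [ChartedSpace F N] [IsManifold 𝓘(ℝ, F) ∞ N]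

/-- The pushed field is the composite of the tangent map of `f` with `U`. -/
theorem contMDiff_pushVF {f : N → M} (hf : ContMDiff 𝓘(ℝ, F) 𝓘(ℝ, E) ∞ f)
    {U : ∀ x : N, TangentSpace 𝓘(ℝ, F) x} (hU : IsSmoothVF U) :
    ContMDiff 𝓘(ℝ, F) 𝓘(ℝ, E).tangent ∞
      (fun y => (⟨f y, pushVF f U y⟩ : TangentBundle 𝓘(ℝ, E) M)) :=
  (hf.contMDiff_tangentMap (m := ∞) (by simp)).comp hU

/-- A torsion-free connection induces a torsion-free connection along a map. -/
theorem covAlong_pushVF_sub_covAlong_pushVF [CompleteSpace E] [CompleteSpace F]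
    {cov : CovariantDerivative 𝓘(ℝ, E) E (TangentSpace 𝓘(ℝ, E) : M → Type _)}
    (htor : ∀ X Y : (∀ x : M, TangentSpace 𝓘(ℝ, E) x), ∀ x, VFDiffAt X x → VFDiffAt Y x →
      cov Y x (X x) - cov X x (Y x) = mlieBracket 𝓘(ℝ, E) X Y x)
    {f : N → M} (hf : ContMDiff 𝓘(ℝ, F) 𝓘(ℝ, E) ∞ f)
    {W U : ∀ x : N, TangentSpace 𝓘(ℝ, F) x} {x : N} (hW : VFDiffAt W x) (hU : VFDiffAt U x) :
    covAlong cov f (pushVF f U) x (W x) - covAlong cov f (pushVF f W) x (U x) =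
      mfderiv 𝓘(ℝ, F) 𝓘(ℝ, E) f x (mlieBracket 𝓘(ℝ, F) W U x) := by
  set t := trivializationAt E (TangentSpace 𝓘(ℝ, E) : M → Type _) (f x) with ht
  have hx : f x ∈ t.baseSet := FiberBundle.mem_baseSet_trivializationAt' (f x)
  set φ := extChartAt 𝓘(ℝ, E) (f x)
  have : IsManifold 𝓘(ℝ, E) 1 M := .of_le (n := ∞) (by simp)
  -- The trivialization is `dφ`, so pushed fields have coordinates `d(φ ∘ f)`; their antisymmetrized
  -- derivatives then give `d(φ ∘ f)[W, U]` by `mvfderiv_mlieBracket`.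
  have hcoord : ∀ᶠ y in 𝓝 x, ∀ v : TangentSpace 𝓘(ℝ, F) y,
      (t ⟨f y, mfderiv 𝓘(ℝ, F) 𝓘(ℝ, E) f y v⟩).2 = mvfderiv 𝓘(ℝ, F) (φ ∘ f) y v := by
    filter_upwards [hf.continuous.continuousAt.eventually
      ((chartAt E (f x)).open_source.mem_nhds (mem_chart_source E (f x)))] with y hy v
    rw [trivializationAt_tangentSpace_snd hy, mvfderiv_comp_mfderiv
      (mdifferentiableAt_extChartAt hy) ((hf y).mdifferentiableAt (by simp))]
  have hpush (V : ∀ y : N, TangentSpace 𝓘(ℝ, F) y) :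
      (fun y => (t ⟨f y, pushVF f V y⟩).2) =ᶠ[𝓝 x]
        fun y => mvfderiv 𝓘(ℝ, F) (φ ∘ f) y (V y) :=
    hcoord.mono fun y hy => hy (V y)
  have hφf : ContMDiffAt 𝓘(ℝ, F) 𝓘(ℝ, E) 2 (φ ∘ f) x :=
    (contMDiffAt_two_extChartAt (mem_chart_source E (f x))).comp x
      ((hf x).of_le ENat.LEInfty.out)
  have hbr := mvfderiv_mlieBracket hφf hW hU
  -- The connection terms of `covAlong` cancel: their difference is the bracket of two coordinate
  -- fields, which is zero.
  have htf := htor (extend E (pushVF f W x)) (extend E (pushVF f U x)) (f x)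
    (mdifferentiableAt_extend 𝓘(ℝ, E) E _) (mdifferentiableAt_extend 𝓘(ℝ, E) E _)
  rw [mlieBracket_extend, extend_apply_self, extend_apply_self] at htf
  have hsub (a b : E) : t.symm (f x) (a - b) = t.symm (f x) a - t.symm (f x) b := by
    have := map_sub (t.symmL ℝ (f x)) a b
    simpa only [t.symmL_apply (R := ℝ) hx] using this
  have hbr' := congr(t.symm (f x) $hbr)
  rw [hsub, ← hcoord.self_of_nhds, t.symm_apply_apply_mk hx] at hbr'
  rw [hbr', covAlong, covAlong, ← ht, mvfderiv_congr (hpush U), mvfderiv_congr (hpush W)]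
  change _ + cov (extend E (pushVF f U x)) (f x) (pushVF f W x)
    - (_ + cov (extend E (pushVF f W x)) (f x) (pushVF f U x)) = _
  rw [sub_eq_zero.1 htf]
  abel

end PushForward

/-! ### Linear algebra of the lightlike splitting and the criterion. -/

namespace LightlikeSubmanifold

variable {E : Type*} [NormedAddCommGroup E] [NormedSpace ℝ E]
  {M : Type*} [TopologicalSpace M] [ChartedSpace E M] [IsManifold 𝓘(ℝ, E) ∞ M]
  {F : Type*} [NormedAddCommGroup F] [NormedSpace ℝ F]
  {N : Type*} [TopologicalSpace N] [ChartedSpace F N] [IsManifold 𝓘(ℝ, F) ∞ N]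
  {g : SemiRiemannianMetric E M} (L : LightlikeSubmanifold (F := F) N g)

/-- The metric pairs the radical and the lightlike transversal bundle without kernel in the
radical. -/
theorem eq_zero_of_mem_radical_of_orth_ltr {x : N} {ξ : TangentSpace 𝓘(ℝ, F) x}
    (hξ : ξ ∈ radical (F := F) g L.toFun x)
    (h : ∀ ν ∈ L.ltr x, g.inner (L.toFun x) (mfderiv 𝓘(ℝ, F) 𝓘(ℝ, E) L.toFun x ξ) ν = 0) :
    ξ = 0 := by
  -- `ξ` is orthogonal to `TN` as a radical vector, to `S(TN^⊥)` since that lies in `TN^⊥`, and to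
  -- `ltr(TN)` by `h`; these span, so nondegeneracy of `g` applies.
  refine L.injective_mfderiv x (Eq.trans (g.nondegenerate _ _ fun w => ?_) (map_zero _).symm)
  have hw : w ∈ tangentImage (F := F) L.toFun x ⊔ (L.ltr x ⊔ L.screenTrans x) := by
    rw [(L.tr_isCompl x).sup_eq_top]
    trivial
  obtain ⟨a, ha, c, hc, rfl⟩ := Submodule.mem_sup.1 hw
  obtain ⟨l, hl, z, hz, rfl⟩ := Submodule.mem_sup.1 hc
  have hzn : z ∈ normalSpace (F := F) g L.toFun x := by
    rw [← L.screenTrans_sup x]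
    exact Submodule.mem_sup_right hz
  have hz' : g.inner (L.toFun x) z (mfderiv 𝓘(ℝ, F) 𝓘(ℝ, E) L.toFun x ξ) = 0 := hzn _ ⟨ξ, rfl⟩
  have ha' : g.inner (L.toFun x) (mfderiv 𝓘(ℝ, F) 𝓘(ℝ, E) L.toFun x ξ) a = 0 := hξ a ha
  rw [map_add, map_add, h l hl, g.symm _ _ z, hz', ha', add_zero, add_zero]

/-- A tangent vector `ξ + s` with `ξ` radical and `s` in the screen is mapped by `J` to a vector
with screen transversal part `J ξ`. -/
theorem projection_screenTrans_map_add
    {J : ∀ x : M, TangentSpace 𝓘(ℝ, E) x →L[ℝ] TangentSpace 𝓘(ℝ, E) x}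
    (hL : L.IsRadicalScreenTransversal J) {x : N} {ξ s : TangentSpace 𝓘(ℝ, F) x}
    (hξ : ξ ∈ radical (F := F) g L.toFun x) (hs : s ∈ L.screen x) :
    Submodule.projection (L.screenTrans x) (tangentImage (F := F) L.toFun x ⊔ L.ltr x)
        (L.screenTrans_isCompl x)
        (J (L.toFun x) (mfderiv 𝓘(ℝ, F) 𝓘(ℝ, E) L.toFun x (ξ + s))) =
      J (L.toFun x) (mfderiv 𝓘(ℝ, F) 𝓘(ℝ, E) L.toFun x ξ) := by
  have h1 : J (L.toFun x) (mfderiv 𝓘(ℝ, F) 𝓘(ℝ, E) L.toFun x ξ) ∈ L.screenTrans x :=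
    hL.map_radical_le x ⟨_, ⟨ξ, hξ, rfl⟩, rfl⟩
  have h2 : J (L.toFun x) (mfderiv 𝓘(ℝ, F) 𝓘(ℝ, E) L.toFun x s) ∈
      tangentImage (F := F) L.toFun x ⊔ L.ltr x := by
    have : J (L.toFun x) (mfderiv 𝓘(ℝ, F) 𝓘(ℝ, E) L.toFun x s) ∈ pushSub L.toFun x (L.screen x) :=
      hL.map_screen_eq x ▸ ⟨_, ⟨s, hs, rfl⟩, rfl⟩
    obtain ⟨u, -, hu⟩ := this
    exact Submodule.mem_sup_left ⟨u, hu⟩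
  rw [map_add, map_add, map_add, Submodule.projection_apply_of_mem_left _ h1,
    (Submodule.projection_apply_eq_zero_iff _).2 h2, add_zero]

/-- `g(J ξ, J ν) = q g(ξ, ν)` for `ξ` radical and `ν` lightlike transversal. -/
theorem inner_map_radical_map_ltr {p q : ℕ}
    {J : ∀ x : M, TangentSpace 𝓘(ℝ, E) x →L[ℝ] TangentSpace 𝓘(ℝ, E) x}
    (hJ : IsMetallic g p q J) (hL : L.IsRadicalScreenTransversal J)
    {x : N} {ξ : TangentSpace 𝓘(ℝ, F) x} (hξ : ξ ∈ radical (F := F) g L.toFun x)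
    {ν : TangentSpace 𝓘(ℝ, E) (L.toFun x)} (hν : ν ∈ L.ltr x) :
    g.inner (L.toFun x) (J (L.toFun x) (mfderiv 𝓘(ℝ, F) 𝓘(ℝ, E) L.toFun x ξ)) (J (L.toFun x) ν) =
      q * g.inner (L.toFun x) (mfderiv 𝓘(ℝ, F) 𝓘(ℝ, E) L.toFun x ξ) ν := by
  -- `Jξ` lies in `S(TN^⊥)`, hence is orthogonal to `ν`; this kills the `p` term of `J²`.
  have h1 := L.ltr_orth_screenTrans x ν hν _ (hL.map_radical_le x ⟨_, ⟨ξ, hξ, rfl⟩, rfl⟩)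
  rw [g.symm] at h1
  rw [← hJ.compat, hJ.sq, map_add, map_smul, map_smul]
  simp only [add_apply, smul_apply, smul_eq_mul]
  exact (congrArg₂ _ (mul_eq_zero_of_right _ h1) rfl).trans (zero_add _)

variable [FiniteDimensional ℝ E] [FiniteDimensional ℝ F]

/-- For screen fields `W`, `U` the difference `h^s(W, J U) - h^s(U, J W)` is the screen transversal
part of `J [W, U]`. -/
theorem hs_sub_hs
    {cov : CovariantDerivative 𝓘(ℝ, E) E (TangentSpace 𝓘(ℝ, E) : M → Type _)}
    (hcov : IsLeviCivita g cov) {p q : ℕ}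
    {J : ∀ x : M, TangentSpace 𝓘(ℝ, E) x →L[ℝ] TangentSpace 𝓘(ℝ, E) x}
    (hJ : IsLocallyMetallic g cov p q J)
    {W U : ∀ x : N, TangentSpace 𝓘(ℝ, F) x} (hW : IsSmoothVF W) (hU : IsSmoothVF U) (x : N) :
    L.hs cov W (fun y => J (L.toFun y) (pushVF L.toFun U y)) x
        - L.hs cov U (fun y => J (L.toFun y) (pushVF L.toFun W y)) x =
      Submodule.projection (L.screenTrans x) (tangentImage (F := F) L.toFun x ⊔ L.ltr x)
        (L.screenTrans_isCompl x)
        (J (L.toFun x) (mfderiv 𝓘(ℝ, F) 𝓘(ℝ, E) L.toFun x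
          (VectorField.mlieBracket 𝓘(ℝ, F) W U x))) := by
  have hf : MDifferentiableAt 𝓘(ℝ, F) 𝓘(ℝ, E) L.toFun x :=
    (L.contMDiff x).mdifferentiableAt (by simp)
  have hpar (V : ∀ x : N, TangentSpace 𝓘(ℝ, F) x) (hV : IsSmoothVF V) :=
    covAlong_parallel hJ.contMDiff hJ.parallel hf
      ((contMDiff_pushVF L.contMDiff hV x).mdifferentiableAt (by simp))
  have : CompleteSpace E := FiniteDimensional.complete ℝ E
  have : CompleteSpace F := FiniteDimensional.complete ℝ F
  rw [hs, hs, hpar U hU, hpar W hW, ← map_sub, ← map_sub,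
    covAlong_pushVF_sub_covAlong_pushVF hcov.torsionFree L.contMDiff
      ((hW x).mdifferentiableAt (by simp)) ((hU x).mdifferentiableAt (by simp))]

/-- The pointwise form of the integrability criterion. -/
theorem mlieBracket_mem_screen_iff
    {cov : CovariantDerivative 𝓘(ℝ, E) E (TangentSpace 𝓘(ℝ, E) : M → Type _)}
    (hcov : IsLeviCivita g cov) {p q : ℕ}
    {J : ∀ x : M, TangentSpace 𝓘(ℝ, E) x →L[ℝ] TangentSpace 𝓘(ℝ, E) x}
    (hJ : IsLocallyMetallic g cov p q J) (hL : L.IsRadicalScreenTransversal J)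
    {W U : ∀ x : N, TangentSpace 𝓘(ℝ, F) x} (hW : IsSmoothVF W) (hU : IsSmoothVF U) (x : N) :
    VectorField.mlieBracket 𝓘(ℝ, F) W U x ∈ L.screen x ↔
      HasNoComponentIn g (L.toFun x)
        (L.hs cov W (fun y => J (L.toFun y) (pushVF L.toFun U y)) x
          - L.hs cov U (fun y => J (L.toFun y) (pushVF L.toFun W y)) x)
        ((L.ltr x).map (J (L.toFun x)).toLinearMap) := by
  rw [L.hs_sub_hs hcov hJ hW hU]
  have hb : VectorField.mlieBracket 𝓘(ℝ, F) W U x ∈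
      radical (F := F) g L.toFun x ⊔ L.screen x := by
    rw [(L.screen_isCompl x).sup_eq_top]
    trivial
  obtain ⟨ξ, hξ, s, hs, hb⟩ := Submodule.mem_sup.1 hb
  -- Both sides now concern `ξ` alone: membership of `ξ` in the screen, against `Jξ` orthogonal to
  -- `J ltr(TN)`.
  rw [← hb, L.projection_screenTrans_map_add hL hξ hs, (L.screen x).add_mem_iff_left hs]
  constructor
  · intro h
    have : ξ = 0 := Submodule.disjoint_def.1 (L.screen_isCompl x).disjoint ξ hξ h
    intro d _
    simp [this]
  · intro h
    have hq : (q : ℝ) ≠ 0 := by exact_mod_cast hJ.q_pos.ne'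
    have : ξ = 0 := by
      refine L.eq_zero_of_mem_radical_of_orth_ltr hξ fun ν hν => ?_
      have := h _ ⟨ν, hν, rfl⟩
      exact (mul_eq_zero.1
        ((L.inner_map_radical_map_ltr hJ.toIsMetallic hL hξ hν).symm.trans this)).resolve_left hq
    rw [this]
    exact zero_mem _

end LightlikeSubmanifold

end LightlikeGeometry

theorem mainTheorem9
    {E : Type*} [NormedAddCommGroup E] [NormedSpace ℝ E] [FiniteDimensional ℝ E]
    {M : Type*} [TopologicalSpace M] [T2Space M] [ChartedSpace E M] [IsManifold 𝓘(ℝ, E) ∞ M]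
    {F : Type*} [NormedAddCommGroup F] [NormedSpace ℝ F] [FiniteDimensional ℝ F]
    {N : Type*} [TopologicalSpace N] [T2Space N] [ChartedSpace F N] [IsManifold 𝓘(ℝ, F) ∞ N]
    (g : LightlikeGeometry.SemiRiemannianMetric E M)
    (cov : CovariantDerivative 𝓘(ℝ, E) E (TangentSpace 𝓘(ℝ, E) : M → Type _))
    (hcov : LightlikeGeometry.IsLeviCivita g cov)
    (p q : ℕ)
    (J : ∀ x : M, TangentSpace 𝓘(ℝ, E) x →L[ℝ] TangentSpace 𝓘(ℝ, E) x)
    (hJ : LightlikeGeometry.IsLocallyMetallic g cov p q J)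
    (L : LightlikeGeometry.LightlikeSubmanifold (F := F) N g)
    (hL : L.IsRadicalScreenTransversal J) :
    LightlikeGeometry.IsIntegrable L.screen ↔
      ∀ W U : (∀ x : N, TangentSpace 𝓘(ℝ, F) x),
        LightlikeGeometry.IsSectionOf L.screen W → LightlikeGeometry.IsSectionOf L.screen U →
        ∀ x : N, LightlikeGeometry.HasNoComponentIn g (L.toFun x)
          (L.hs cov W (fun y => J (L.toFun y) (LightlikeGeometry.pushVF L.toFun U y)) x
            - L.hs cov U (fun y => J (L.toFun y) (LightlikeGeometry.pushVF L.toFun W y)) x)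
          ((L.ltr x).map (J (L.toFun x)).toLinearMap) := by
  exact ⟨fun h W U hW hU x => (L.mlieBracket_mem_screen_iff hcov hJ hL hW.1 hU.1 x).1 (h W U hW hU x),
    fun h W U hW hU x => (L.mlieBracket_mem_screen_iff hcov hJ hL hW.1 hU.1 x).2 (h W U hW hU x)⟩
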